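/- Let $(X,d)$ be a compact metric space and let $f:X\to X$ be a continuous map with finite topological entropy. Let $\mathcal M$ be the set of $f$-invariant Borel probability measures on $X$ with the weak$^*$ topology, and let $h_\mu(f)$ denote the measure-theoretic entropy of $\mu\in\mathcal M$; assume that $\mu\mapsto h_\mu(f)$ is upper semicontinuous on $\mathcal M$. For a continuous $\varphi:X\to\mathbb R$ let $ES(\varphi)$ be the set of equilibrium states of $\varphi$, i.e. of those $\mu\in\mathcal M$ with $h_\mu(f)+\int\varphi\,d\mu=\sup_{\nu\in\mathcal M}\left(h_\nu(f)+\int\varphi\,d\nu\right)$. A measure $\mu\in\mathcal M$ is a ground state of $\varphi$ if there are an increasing sequence of real numbers $t_n\to\infty$ and $\mu_n\in ES(t_n\varphi)$ with $\mu_n\to\mu$. Let $\Phi=(\phi_1,\dots,\phi_m):X\to\mathbb R^m$ be continuous, let ${\rm rv}(\mu)=\left(\int\phi_1\,d\mu,\dots,\int\phi_m\,d\mu\right)$ be the rotation vector of $\mu\in\mathcal M$, and let ${\rm Rot}(\Phi)=\{{\rm rv}(\mu):\mu\in\mathcal M\}$. Let $\alpha\in\mathbb R^m$ be a direction vector, i.e.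 $\|\alpha\|=1$ in the Euclidean norm. Let $H_\alpha(\Phi)$ be the supporting hyperplane of ${\rm Rot}(\Phi)$ for which $\alpha$ is the normal vector pointing away from ${\rm Rot}(\Phi)$, let $F_\alpha(\Phi)={\rm Rot}(\Phi)\cap H_\alpha(\Phi)$, and let $GS(\alpha)$ be the set of ground states of $\alpha\cdot\Phi=\alpha_1\phi_1+\dots+\alpha_m\phi_m$. Then: (a) If $\mu\in GS(\alpha)$, then ${\rm rv}(\mu)\in F_\alpha(\Phi)$ and $h_\mu(f)=\sup\{h_\nu(f):\nu\in\mathcal M,\ {\rm rv}(\nu)\in F_\alpha(\Phi)\}$. (b) The set $\{{\rm rv}(\mu):\mu\in GS(\alpha)\}$ is compact. Further, if there is $t_0\in\mathbb R$ such that for every $t\ge t_0$ the potential $t\,\alpha\cdot\Phi$ has a unique equilibrium state $\mu_t$, and if $t\mapsto{\rm rv}(\mu_t)$ is continuous on $[t_0,\infty)$, then $\{{\rm rv}(\mu):\mu\in GS(\alpha)\}$ is connected. -/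

import Mathlib

open MeasureTheory Filter Topology

noncomputable section

namespace GroundStates

section Dynamics

variable {X : Type*} [MetricSpace X] [CompactSpace X] [MeasurableSpace X] [BorelSpace X]

/-- The space of `f`-invariant Borel probability measures on `X`; as a subtype of
`ProbabilityMeasure X` it carries the weak-star topology. -/
abbrev InvMeasure (f : X → X) : Type _ :=
  {μ : ProbabilityMeasure X // MeasurePreserving f (μ : Measure X) (μ : Measure X)}

/-- The `n`-itinerary of a point with respect to a finite partition, the latter being encoded by
the map `P : X → Fin k` sending a point to the label of its cell. The fibres of `itinerary f P n`
are the cells of the join of the partitions `f⁻ⁱ P`, `0 ≤ i < n`. -/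
def itinerary (f : X → X) {k : ℕ} (P : X → Fin k) (n : ℕ) (x : X) : Fin n → Fin k :=
  fun i => P (f^[(i : ℕ)] x)

/-- The Shannon entropy `-∑ μ(A) log μ(A)` of the join of the partitions `f⁻ⁱ P`, `0 ≤ i < n`. -/
def joinEntropy (f : X → X) (μ : ProbabilityMeasure X) {k : ℕ} (P : X → Fin k) (n : ℕ) : ℝ :=
  ∑ a : Fin n → Fin k, Real.negMulLog ((μ : Measure X).real (itinerary f P n ⁻¹' {a}))

/-- The entropy `h_μ(f, P) = lim (1/n) H_μ(⋁_{i<n} f⁻ⁱ P)` of `f` relative to the partition `P`.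
For invariant `μ` the limit exists, so it agrees with the upper limit used here. -/
def partitionEntropy (f : X → X) (μ : ProbabilityMeasure X) {k : ℕ} (P : X → Fin k) : EReal :=
  limsup (fun n : ℕ => ((joinEntropy f μ P n / n : ℝ) : EReal)) atTop

/-- The measure-theoretic (Kolmogorov-Sinai) entropy `h_μ(f)`: the supremum of `h_μ(f, P)` over
all finite measurable partitions `P`. It may be infinite. -/
def entropy (f : X → X) (μ : InvMeasure f) : EReal :=
  ⨆ (k : ℕ) (P : X → Fin k) (_ : Measurable P), partitionEntropy f μ.1 P

/-- The free energy `h_μ(f) + ∫ φ dμ`. -/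
def freeEnergy (f : X → X) (φ : X → ℝ) (μ : InvMeasure f) : EReal :=
  entropy f μ + ((∫ x, φ x ∂(μ.1 : Measure X) : ℝ) : EReal)

/-- The set of equilibrium states of the potential `φ`. -/
def equilibriumStates (f : X → X) (φ : X → ℝ) : Set (InvMeasure f) :=
  {μ | freeEnergy f φ μ = ⨆ ν : InvMeasure f, freeEnergy f φ ν}

/-- The set of ground states of the potential `φ`: weak-star limits of equilibrium states of
`tₙ φ` for some increasing sequence `tₙ → ∞`. -/
def groundStates (f : X → X) (φ : X → ℝ) : Set (InvMeasure f) :=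
  {μ | ∃ (t : ℕ → ℝ) (ν : ℕ → InvMeasure f), StrictMono t ∧ Tendsto t atTop atTop ∧
    (∀ n, ν n ∈ equilibriumStates f (fun x => t n * φ x)) ∧ Tendsto ν atTop (𝓝 μ)}

variable {m : ℕ}

/-- The rotation vector `(∫ φ₁ dμ, …, ∫ φₘ dμ)` of an invariant measure. -/
def rv {f : X → X} (Φ : C(X, EuclideanSpace ℝ (Fin m))) (μ : InvMeasure f) :
    EuclideanSpace ℝ (Fin m) :=
  WithLp.toLp 2 (fun i => ∫ x, Φ x i ∂(μ.1 : Measure X))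

/-- The generalized rotation set of `Φ`. -/
def rotationSet (f : X → X) (Φ : C(X, EuclideanSpace ℝ (Fin m))) :
    Set (EuclideanSpace ℝ (Fin m)) :=
  Set.range (rv (f := f) Φ)

/-- The one-dimensional potential `α · Φ = α₁ φ₁ + ⋯ + αₘ φₘ`. -/
def dirPotential (α : EuclideanSpace ℝ (Fin m)) (Φ : C(X, EuclideanSpace ℝ (Fin m))) (x : X) : ℝ :=
  ∑ i, α i * Φ x i

end Dynamics

section Convex

variable {m : ℕ}

/-- The hyperplane `{u : u · α = a}`. -/
def hyperplane (α : EuclideanSpace ℝ (Fin m)) (a : ℝ) : Set (EuclideanSpace ℝ (Fin m)) :=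
  {u | inner ℝ α u = a}

/-- The hyperplane `{u : u · α = a}` cuts `K`: both its open half spaces contain points of `K`. -/
def Cuts (K : Set (EuclideanSpace ℝ (Fin m))) (α : EuclideanSpace ℝ (Fin m)) (a : ℝ) : Prop :=
  (∃ v ∈ K, inner ℝ α v < a) ∧ ∃ v ∈ K, a < inner ℝ α v

/-- The hyperplane `{u : u · α = a}` is a supporting hyperplane of `K`: its distance to `K` is
zero, but it does not cut `K`. -/
def IsSupporting (K : Set (EuclideanSpace ℝ (Fin m))) (α : EuclideanSpace ℝ (Fin m)) (a : ℝ) :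
    Prop :=
  (∀ ε > 0, ∃ v ∈ K, ∃ w ∈ hyperplane α a, dist v w < ε) ∧ ¬ Cuts K α a

/-- The normal vector `α` of the hyperplane `{u : u · α = a}` points away from `K`: the open
half space into which `α` points contains no point of `K`. -/
def PointsAway (K : Set (EuclideanSpace ℝ (Fin m))) (α : EuclideanSpace ℝ (Fin m)) (a : ℝ) : Prop :=
  ∀ v ∈ K, ¬ a < inner ℝ α v

/-- The supporting hyperplane of `K` for which `α` is the normal vector pointing away from `K`,
as the set of all points `u` such that the hyperplane through `u` normal to `α` has this
property. (For compact non-empty `K` and `α ≠ 0` there is exactly one such hyperplane.) -/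
def supportingHyperplane (K : Set (EuclideanSpace ℝ (Fin m))) (α : EuclideanSpace ℝ (Fin m)) :
    Set (EuclideanSpace ℝ (Fin m)) :=
  {u | IsSupporting K α (inner ℝ α u) ∧ PointsAway K α (inner ℝ α u)}

end Convex

/-- The face `F_α(Φ) = Rot(Φ) ∩ H_α(Φ)` of the rotation set. -/
def face {X : Type*} [MetricSpace X] [CompactSpace X] [MeasurableSpace X] [BorelSpace X] {m : ℕ}
    (f : X → X) (Φ : C(X, EuclideanSpace ℝ (Fin m))) (α : EuclideanSpace ℝ (Fin m)) :
    Set (EuclideanSpace ℝ (Fin m)) :=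
  rotationSet f Φ ∩ supportingHyperplane (rotationSet f Φ) α

end GroundStates

end

/-!
Entropy is bounded by Goodwyn's theorem `h_μ(f) ≤ h_top(f)`: up to errors of small frequency, the
`P`-itinerary of a point agrees with a word read off from a dynamical cover, and by Gibbs'
inequality its entropy is at most its cross entropy against the law of a noisy copy of a uniformly
chosen such word.

For an equilibrium state `μ_t` of `tφ` and every invariant `ν`,
`h_ν + t ∫ φ dν ≤ h_{μ_t} + t ∫ φ dμ_t`. Dividing by `t → ∞` shows that ground states maximize
`∫ φ`, that is, their rotation vectors lie on the face. If `ν` itself maximizes `∫ φ`, the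
inequality leaves `h_ν ≤ h_{μ_t}`, which passes to the limit by upper semicontinuity.

The ground states form the decreasing intersection, as `T → ∞`, of the closures of the sets of
equilibrium states of `tφ` with `t ≥ T`. This gives compactness, and connectedness of the set of
rotation vectors when `t ↦ rv(μ_t)` is continuous, since the `T`-th set then has the closure of a
continuous image of a half-line as its image.
-/

namespace GroundStates

section InformationTheory

/-- The Shannon entropy of a random variable `Y` with finitely many values; the entropy of a join
of partitions is that of the itinerary. -/
noncomputable def shannonEntropy {Ω ι : Type*} [MeasurableSpace Ω] [Fintype ι] (μ : Measure Ω)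
    (Y : Ω → ι) : ℝ :=
  ∑ i, Real.negMulLog (μ.real (Y ⁻¹' {i}))

/-- The law of a noisy copy of the letter `b`: it is kept with probability `c`, and otherwise
replaced by a uniformly chosen letter (possibly `b` again). -/
noncomputable def noisyLetter {κ : Type*} [Fintype κ] [DecidableEq κ] (c : ℝ) (b a : κ) : ℝ :=
  (if a = b then c else 0) + (1 - c) / Fintype.card κ

/-- The law of a noisy copy of the word `b`, whose letters are perturbed independently. -/
noncomputable def noisyWord {ι κ : Type*} [Fintype ι] [Fintype κ] [DecidableEq κ] (c : ℝ)
    (b a : ι → κ) : ℝ :=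
  ∏ i, noisyLetter c (b i) (a i)

lemma negMulLog_le_mul_neg_log_add_sub {p q : ℝ} (hp : 0 ≤ p) (hq : 0 < q) :
    Real.negMulLog p ≤ p * -Real.log q + (q - p) := by
  rcases hp.eq_or_lt with rfl | hp
  · simpa using hq.le
  have hlog : Real.log q - Real.log p ≤ q / p - 1 := by
    rw [← Real.log_div hq.ne' hp.ne']
    exact Real.log_le_sub_one_of_pos (div_pos hq hp)
  calc Real.negMulLog p = p * -Real.log q + p * (Real.log q - Real.log p) := by
        rw [Real.negMulLog]; ring
    _ ≤ p * -Real.log q + p * (q / p - 1) := by gcongr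
    _ = p * -Real.log q + (q - p) := by field_simp

lemma sum_negMulLog_le_sum_mul_neg_log {ι : Type*} [Fintype ι] {p q : ι → ℝ}
    (hp : ∀ i, 0 ≤ p i) (hq : ∀ i, 0 < q i) (hpq : ∑ i, q i ≤ ∑ i, p i) :
    ∑ i, Real.negMulLog (p i) ≤ ∑ i, p i * -Real.log (q i) :=
  calc ∑ i, Real.negMulLog (p i) ≤ ∑ i, (p i * -Real.log (q i) + (q i - p i)) :=
        Finset.sum_le_sum fun i _ => negMulLog_le_mul_neg_log_add_sub (hp i) (hq i)
    _ = ∑ i, p i * -Real.log (q i) + (∑ i, q i - ∑ i, p i) := by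
        rw [Finset.sum_add_distrib, Finset.sum_sub_distrib]
    _ ≤ ∑ i, p i * -Real.log (q i) := by linarith

lemma shannonEntropy_nonneg {Ω ι : Type*} [MeasurableSpace Ω] [Fintype ι] (μ : Measure Ω)
    [IsProbabilityMeasure μ] (Y : Ω → ι) : 0 ≤ shannonEntropy μ Y :=
  Finset.sum_nonneg fun _ _ => Real.negMulLog_nonneg measureReal_nonneg measureReal_le_one

lemma shannonEntropy_le_integral_neg_log {Ω ι : Type*} [MeasurableSpace Ω] [Fintype ι]
    [MeasurableSpace ι] [MeasurableSingletonClass ι] {μ : Measure Ω} [IsProbabilityMeasure μ]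
    {Y : Ω → ι} (hY : Measurable Y) {q : ι → ℝ} (hq : ∀ i, 0 < q i) (hq_sum : ∑ i, q i ≤ 1) :
    shannonEntropy μ Y ≤ ∫ ω, -Real.log (q (Y ω)) ∂μ := by
  have := Measure.isProbabilityMeasure_map (μ := μ) hY.aemeasurable
  have hlaw (i : ι) : μ.real (Y ⁻¹' {i}) = (μ.map Y).real {i} :=
    (map_measureReal_apply hY (measurableSet_singleton i)).symm
  calc shannonEntropy μ Y = ∑ i, Real.negMulLog ((μ.map Y).real {i}) := by
        simp only [shannonEntropy, hlaw]
    _ ≤ ∑ i, (μ.map Y).real {i} * -Real.log (q i) := by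
        refine sum_negMulLog_le_sum_mul_neg_log (fun _ => measureReal_nonneg) hq ?_
        rwa [sum_measureReal_singleton, Finset.coe_univ, probReal_univ]
    _ = ∫ i, -Real.log (q i) ∂μ.map Y := by
        simp only [integral_fintype .of_finite, smul_eq_mul]
    _ = ∫ ω, -Real.log (q (Y ω)) ∂μ :=
        integral_map hY.aemeasurable (measurable_of_finite _).aestronglyMeasurable

section Noise

variable {ι κ : Type*} [Fintype ι] [Fintype κ] [DecidableEq κ] {c : ℝ}

lemma sum_noisyLetter (c : ℝ) (b : κ) : ∑ a, noisyLetter c b a = 1 := by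
  have : Nonempty κ := ⟨b⟩
  simp only [noisyLetter, Finset.sum_add_distrib, Finset.sum_ite_eq', Finset.mem_univ, if_true,
    Finset.sum_const, Finset.card_univ, nsmul_eq_mul]
  field_simp
  ring

lemma noisyLetter_pos (hc₀ : 0 < c) (hc₁ : c < 1) (b a : κ) : 0 < noisyLetter c b a := by
  have : 0 < Fintype.card κ := Fintype.card_pos_iff.2 ⟨b⟩
  have : 0 < (1 - c) / Fintype.card κ := div_pos (sub_pos.2 hc₁) (by positivity)
  unfold noisyLetter
  split_ifs <;> positivity

lemma neg_log_noisyLetter_le (hc₀ : 0 < c) (hc₁ : c < 1) (b a : κ) :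
    -Real.log (noisyLetter c b a) ≤
      -Real.log c + if a ≠ b then Real.log (Fintype.card κ / (1 - c)) else 0 := by
  by_cases h : a = b
  · have hle : c ≤ noisyLetter c b a := by
      simpa [noisyLetter, h] using div_nonneg (sub_nonneg.2 hc₁.le) (Nat.cast_nonneg _)
    simpa [h] using Real.log_le_log hc₀ (h ▸ hle)
  · have hlog : -Real.log (noisyLetter c b a) = Real.log (Fintype.card κ / (1 - c)) := by
      rw [noisyLetter, if_neg h, zero_add, ← Real.log_inv, inv_div]
    rw [hlog, if_pos h]
    exact le_add_of_nonneg_left (neg_nonneg.2 (Real.log_nonpos hc₀.le hc₁.le))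

lemma sum_noisyWord [DecidableEq ι] (c : ℝ) (b : ι → κ) : ∑ a, noisyWord c b a = 1 := by
  simp only [noisyWord, ← Fintype.prod_sum, sum_noisyLetter, Finset.prod_const_one]

lemma noisyWord_pos (hc₀ : 0 < c) (hc₁ : c < 1) (b a : ι → κ) : 0 < noisyWord c b a :=
  Finset.prod_pos fun _ _ => noisyLetter_pos hc₀ hc₁ _ _

lemma neg_log_noisyWord_le (hc₀ : 0 < c) (hc₁ : c < 1) (b a : ι → κ) :
    -Real.log (noisyWord c b a) ≤ Fintype.card ι * -Real.log c +
      hammingDist a b * Real.log (Fintype.card κ / (1 - c)) :=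
  calc -Real.log (noisyWord c b a) = ∑ i, -Real.log (noisyLetter c (b i) (a i)) := by
        rw [noisyWord, Real.log_prod fun i _ => (noisyLetter_pos hc₀ hc₁ _ _).ne',
          Finset.sum_neg_distrib]
    _ ≤ ∑ i, (-Real.log c + if a i ≠ b i then Real.log (Fintype.card κ / (1 - c)) else 0) :=
        Finset.sum_le_sum fun _ _ => neg_log_noisyLetter_le hc₀ hc₁ _ _
    _ = _ := by
        rw [Finset.sum_add_distrib, ← Finset.sum_filter]
        simp only [Finset.sum_const, Finset.card_univ, nsmul_eq_mul, hammingDist]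

end Noise

lemma neg_log_sum_div_card_le {α : Type*} {S : Finset α} {w : α → ℝ} (hw : ∀ s ∈ S, 0 < w s)
    {s : α} (hs : s ∈ S) :
    -Real.log ((∑ s ∈ S, w s) / S.card) ≤ Real.log S.card - Real.log (w s) := by
  have hcard : (0 : ℝ) < S.card := by exact_mod_cast Finset.card_pos.2 ⟨s, hs⟩
  have hle : w s ≤ ∑ s ∈ S, w s := Finset.single_le_sum (fun s hs => (hw s hs).le) hs
  rw [Real.log_div ((hw s hs).trans_le hle).ne' hcard.ne']
  linarith [Real.log_le_log (hw s hs) hle]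

lemma log_natCast_div_one_sub_nonneg {c : ℝ} (hc₀ : 0 ≤ c) (hc₁ : c < 1) (k : ℕ) :
    0 ≤ Real.log (k / (1 - c)) := by
  rcases k.eq_zero_or_pos with rfl | hk
  · simp
  have hk' : (1 : ℝ) ≤ k := by exact_mod_cast hk
  refine Real.log_nonneg ((one_le_div (sub_pos.2 hc₁)).2 ?_)
  linarith

theorem shannonEntropy_le_of_hammingDist_le {Ω ι κ : Type*} [MeasurableSpace Ω] [Fintype ι]
    [DecidableEq ι] [Fintype κ] [DecidableEq κ] [MeasurableSpace κ] [MeasurableSingletonClass κ]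
    {μ : Measure Ω} [IsProbabilityMeasure μ] {Y : Ω → ι → κ} (hY : Measurable Y)
    {W : Finset (ι → κ)} {D : Ω → ℝ} (hD : Integrable D μ)
    (hYW : ∀ ω, ∃ b ∈ W, hammingDist (Y ω) b ≤ D ω) {c : ℝ} (hc₀ : 0 < c) (hc₁ : c < 1) :
    shannonEntropy μ Y ≤ Real.log W.card + Fintype.card ι * -Real.log c +
      (∫ ω, D ω ∂μ) * Real.log (Fintype.card κ / (1 - c)) := by
  obtain ⟨ω₀⟩ : Nonempty Ω := nonempty_of_isProbabilityMeasure μ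
  obtain ⟨b₀, hb₀, -⟩ := hYW ω₀
  have hcard : (0 : ℝ) < W.card := by exact_mod_cast Finset.card_pos.2 ⟨b₀, hb₀⟩
  have hpos (b a : ι → κ) : 0 < noisyWord c b a := noisyWord_pos hc₀ hc₁ b a
  let q (a : ι → κ) : ℝ := (∑ b ∈ W, noisyWord c b a) / W.card
  have hq_pos (a : ι → κ) : 0 < q a :=
    div_pos (Finset.sum_pos (fun b _ => hpos b a) ⟨b₀, hb₀⟩) hcard
  have hq_sum : ∑ a, q a = 1 := by
    rw [← Finset.sum_div, Finset.sum_comm]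
    simp only [sum_noisyWord, Finset.sum_const, nsmul_eq_mul, mul_one]
    exact div_self hcard.ne'
  have hcode (ω : Ω) : -Real.log (q (Y ω)) ≤
      Real.log W.card + Fintype.card ι * -Real.log c +
        D ω * Real.log (Fintype.card κ / (1 - c)) := by
    obtain ⟨b, hb, hdist⟩ := hYW ω
    have hmix := neg_log_sum_div_card_le (fun b _ => hpos b (Y ω)) hb
    have hnoise := neg_log_noisyWord_le hc₀ hc₁ b (Y ω)
    have hD_mul := mul_le_mul_of_nonneg_right hdist
      (log_natCast_div_one_sub_nonneg hc₀.le hc₁ (Fintype.card κ))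
    linarith
  calc shannonEntropy μ Y ≤ ∫ ω, -Real.log (q (Y ω)) ∂μ :=
        shannonEntropy_le_integral_neg_log hY hq_pos hq_sum.le
    _ ≤ ∫ ω, (Real.log W.card + Fintype.card ι * -Real.log c +
          D ω * Real.log (Fintype.card κ / (1 - c))) ∂μ :=
        integral_mono
          ((Integrable.of_finite (f := fun a => -Real.log (q a))).comp_measurable hY)
          ((integrable_const _).add (hD.mul_const _)) hcode
    _ = _ := by
        rw [integral_add (integrable_const _) (hD.mul_const _), integral_const, probReal_univ,
          one_smul, integral_mul_const]

end InformationTheory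

section Goodwyn

lemma measurable_itinerary {X : Type*} [MeasurableSpace X] {f : X → X} (hf : Measurable f) {k : ℕ}
    {P : X → Fin k} (hP : Measurable P) (n : ℕ) : Measurable (itinerary f P n) :=
  measurable_pi_lambda _ fun i => hP.comp (hf.iterate i)

lemma entropy_nonneg {X : Type*} [MeasurableSpace X] (f : X → X) (μ : InvMeasure f) :
    0 ≤ entropy f μ := by
  have hpart : 0 ≤ partitionEntropy f μ.1 (fun _ => (0 : Fin 1)) :=
    le_limsup_of_frequently_le <| Frequently.of_forall fun n => EReal.coe_nonneg.2 <|
      div_nonneg (shannonEntropy_nonneg (μ.1 : Measure X) (itinerary f _ n)) n.cast_nonneg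
  exact hpart.trans (le_iSup_of_le 1 (le_iSup₂_of_le _ measurable_const le_rfl))

lemma integrable_birkhoffSum {X E : Type*} [MeasurableSpace X] {μ : Measure X}
    [NormedAddCommGroup E] {f : X → X} (hf : MeasurePreserving f μ μ) {g : X → E}
    (hg : Integrable g μ) (n : ℕ) : Integrable (birkhoffSum f g n) μ :=
  integrable_finsetSum _ fun i _ => (hf.iterate i).integrable_comp_of_integrable hg

lemma integral_birkhoffSum {X E : Type*} [MeasurableSpace X] {μ : Measure X}
    [NormedAddCommGroup E] [NormedSpace ℝ E] {f : X → X} (hf : MeasurePreserving f μ μ) {g : X → E}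
    (hg : Integrable g μ) (n : ℕ) : ∫ x, birkhoffSum f g n x ∂μ = n • ∫ x, g x ∂μ := by
  have hint (i : ℕ) : Integrable (fun x => g (f^[i] x)) μ :=
    (hf.iterate i).integrable_comp_of_integrable hg
  have hiter (i : ℕ) : ∫ x, g (f^[i] x) ∂μ = ∫ x, g x ∂μ := by
    have hmap := (hf.iterate i).map_eq
    rw [← integral_map (hf.iterate i).aemeasurable (hmap.symm ▸ hg.aestronglyMeasurable), hmap]
  simp only [birkhoffSum]
  rw [integral_finsetSum _ fun i _ => hint i]
  simp only [hiter, Finset.sum_const, Finset.card_range]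

lemma hammingDist_itinerary_le_birkhoffSum {X : Type*} {f : X → X} {k : ℕ} {P j : X → Fin k}
    {B : Set X} {n : ℕ} {x y : X}
    (h : ∀ i < n, f^[i] x ∉ B → P (f^[i] x) = j (f^[i] y)) :
    hammingDist (itinerary f P n x) (itinerary f j n y) ≤
      birkhoffSum f (B.indicator (1 : X → ℝ)) n x := by
  rw [hammingDist, Finset.card_filter, Nat.cast_sum, birkhoffSum,
    ← Fin.sum_univ_eq_sum_range fun i => B.indicator (1 : X → ℝ) (f^[i] x)]
  refine Finset.sum_le_sum fun i _ => ?_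
  by_cases hB : f^[i] x ∈ B
  · rw [Set.indicator_of_mem hB, Pi.one_apply]
    split_ifs <;> simp
  · have heq : itinerary f P n x i = itinerary f j n y i := h i i.2 hB
    rw [if_neg (not_not.2 heq), Nat.cast_zero, Set.indicator_of_notMem hB]

theorem joinEntropy_le_of_isDynCoverOf {X : Type*} [MeasurableSpace X] {f : X → X}
    (μ : InvMeasure f) {k : ℕ} {P : X → Fin k} (hP : Measurable P) {B : Set X}
    (hB : MeasurableSet B) {U : SetRel X X} {j : X → Fin k}
    (hj : ∀ x y, (x, y) ∈ U → x ∉ B → P x = j y) {n : ℕ} {S : Finset X}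
    (hS : Dynamics.IsDynCoverOf f Set.univ U n S) {c : ℝ} (hc₀ : 0 < c) (hc₁ : c < 1) :
    joinEntropy f μ.1 P n ≤
      Real.log S.card + n * (-Real.log c +
        (μ.1 : Measure X).real B * Real.log (k / (1 - c))) := by
  classical
  obtain ⟨x₀⟩ : Nonempty X := nonempty_of_isProbabilityMeasure (μ.1 : Measure X)
  obtain ⟨s₀, hs₀, -⟩ := hS (Set.mem_univ x₀)
  let W := S.image (itinerary f j n)
  have hW : Real.log W.card ≤ Real.log S.card :=
    Real.log_le_log (by exact_mod_cast Finset.card_pos.2 ⟨_, Finset.mem_image_of_mem _ hs₀⟩)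
      (by exact_mod_cast Finset.card_image_le)
  have hone : Integrable (B.indicator (1 : X → ℝ)) (μ.1 : Measure X) :=
    (integrable_const (1 : ℝ)).indicator hB
  have hnear (x : X) : ∃ b ∈ W, hammingDist (itinerary f P n x) b ≤
      birkhoffSum f (B.indicator (1 : X → ℝ)) n x := by
    obtain ⟨s, hs, hxs⟩ := hS (Set.mem_univ x)
    exact ⟨_, Finset.mem_image_of_mem _ hs, hammingDist_itinerary_le_birkhoffSum
      fun i hi => hj _ _ (Dynamics.mem_dynEntourage.1 hxs i hi)⟩
  have hentropy := shannonEntropy_le_of_hammingDist_le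
    (measurable_itinerary μ.2.measurable hP n) (integrable_birkhoffSum μ.2 hone n) hnear hc₀ hc₁
  rw [integral_birkhoffSum μ.2 hone, integral_indicator_one hB, Fintype.card_fin,
    Fintype.card_fin, nsmul_eq_mul] at hentropy
  calc joinEntropy f μ.1 P n ≤ _ := hentropy
    _ ≤ Real.log S.card + n * -Real.log c +
        n * (μ.1 : Measure X).real B * Real.log (k / (1 - c)) := by gcongr
    _ = _ := by ring

lemma exists_isClosed_continuousOn {X κ : Type*} [TopologicalSpace X] [MeasurableSpace X]
    [OpensMeasurableSpace X] {μ : Measure X} [IsFiniteMeasure μ] [μ.WeaklyRegular] [Finite κ]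
    [TopologicalSpace κ] [MeasurableSpace κ] [MeasurableSingletonClass κ] {P : X → κ}
    (hP : Measurable P) {ε : ENNReal} (hε : ε ≠ 0) :
    ∃ G, IsClosed G ∧ μ Gᶜ < ε ∧ ContinuousOn P G := by
  obtain ⟨δ, hδ, hδε⟩ := ENNReal.exists_pos_sum_of_countable' hε κ
  choose F hFP hF hFδ using fun a => (hP (measurableSet_singleton a)).exists_isClosed_sdiff_lt
    (measure_ne_top μ _) (hδ a).ne'
  refine ⟨⋃ a, F a, isClosed_iUnion_of_finite hF, ?_,
    (locallyFinite_of_finite F).continuousOn_iUnion hF fun a =>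
      continuousOn_const.congr fun x hx => hFP a hx⟩
  have hcompl : (⋃ a, F a)ᶜ ⊆ ⋃ a, P ⁻¹' {a} \ F a := fun x hx =>
    Set.mem_iUnion.2 ⟨P x, rfl, fun h => hx (Set.mem_iUnion.2 ⟨P x, h⟩)⟩
  calc μ (⋃ a, F a)ᶜ ≤ ∑' a, μ (P ⁻¹' {a} \ F a) :=
        (measure_mono hcompl).trans (measure_iUnion_le _)
    _ ≤ ∑' a, δ a := ENNReal.tsum_le_tsum fun a => (hFδ a).le
    _ < ε := hδε

lemma exists_label_of_continuousOn {X κ : Type*} [UniformSpace X] [TopologicalSpace κ]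
    [DiscreteTopology κ] {P : X → κ} {G : Set X} (hG : IsCompact G) (hP : ContinuousOn P G) :
    ∃ U ∈ uniformity X, ∃ j : X → κ, ∀ x y, (x, y) ∈ U → x ∈ G → P x = j y := by
  obtain rfl : ‹TopologicalSpace κ› = ⊥ := DiscreteTopology.eq_bot
  let _ : UniformSpace κ := ⊥
  have hunif : {p : X × X | p.1 ∈ G → p.2 ∈ G → P p.1 = P p.2} ∈ uniformity X := by
    have hdiag : ∀ᶠ q : κ × κ in uniformity κ, q.1 = q.2 := mem_principal_self _
    filter_upwards [eventually_inf_principal.1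
      ((hG.uniformContinuousOn_of_continuous hP).eventually hdiag)] with p hp h₁ h₂
    exact hp ⟨h₁, h₂⟩
  obtain ⟨U, hU, hUsymm, hUP⟩ := comp_symm_mem_uniformity_sets hunif
  have hlabel (y : X) : ∃ a, ∀ x ∈ G, (x, y) ∈ U → P x = a := by
    by_cases h : ∃ z ∈ G, (z, y) ∈ U
    · obtain ⟨z, hz, hzy⟩ := h
      exact ⟨P z, fun x hx hxy => @hUP (x, z) ⟨y, hxy, hUsymm.symm _ _ hzy⟩ hx hz⟩
    · exact ⟨P y, fun x hx hxy => absurd ⟨x, hx, hxy⟩ h⟩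
  choose j hj using hlabel
  exact ⟨U, hU, j, fun x y hxy hx => hj y x hx hxy⟩

lemma exists_isDynCoverOf_log_coverMincard_eq {X : Type*} [UniformSpace X] [CompactSpace X]
    [Nonempty X] (f : X → X) {U : SetRel X X} (hU : U ∈ uniformity X) (n : ℕ) :
    ∃ S : Finset X, Dynamics.IsDynCoverOf f Set.univ U n S ∧
      ENNReal.log (Dynamics.coverMincard f Set.univ U n) = Real.log S.card := by
  obtain ⟨S, hS, hcard⟩ := (Dynamics.coverMincard_finite_iff f Set.univ U n).1 <|
    Dynamics.coverMincard_finite_of_isCompact_invariant isCompact_univ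
      (Set.mapsTo_univ f Set.univ) hU n
  obtain ⟨s, hs, -⟩ := hS (Set.mem_univ (Classical.arbitrary X))
  have hpos : S.card ≠ 0 := Finset.card_ne_zero_of_mem hs
  refine ⟨S, hS, ?_⟩
  rw [← hcard, ENat.toENNReal_coe, ENNReal.log_pos_real (by exact_mod_cast hpos)
    (ENNReal.natCast_ne_top _), ENNReal.toReal_natCast]

lemma partitionEntropy_le_coverEntropyEntourage_add {X : Type*} [UniformSpace X] [CompactSpace X]
    [MeasurableSpace X] {f : X → X} (μ : InvMeasure f) {k : ℕ} {P : X → Fin k} (hP : Measurable P)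
    {B : Set X} (hB : MeasurableSet B) {U : SetRel X X} (hU : U ∈ uniformity X) {j : X → Fin k}
    (hj : ∀ x y, (x, y) ∈ U → x ∉ B → P x = j y) {c : ℝ} (hc₀ : 0 < c) (hc₁ : c < 1) :
    partitionEntropy f μ.1 P ≤ Dynamics.coverEntropyEntourage f Set.univ U +
      (-Real.log c + (μ.1 : Measure X).real B * Real.log (k / (1 - c)) : ℝ) := by
  have : Nonempty X := nonempty_of_isProbabilityMeasure (μ.1 : Measure X)
  set δ : ℝ := -Real.log c + (μ.1 : Measure X).real B * Real.log (k / (1 - c))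
  have hle : ∀ᶠ n : ℕ in atTop, ((joinEntropy f μ.1 P n / n : ℝ) : EReal) ≤
      ENNReal.log (Dynamics.coverMincard f Set.univ U n) / n + (δ : EReal) := by
    filter_upwards [eventually_gt_atTop 0] with n hn
    obtain ⟨S, hS, hlog⟩ := exists_isDynCoverOf_log_coverMincard_eq f hU n
    have hjoin := joinEntropy_le_of_isDynCoverOf μ hP hB hj hS hc₀ hc₁
    have hn' : (0 : ℝ) < n := by exact_mod_cast hn
    have hreal : joinEntropy f μ.1 P n / n ≤ Real.log S.card / n + δ := by
      rw [div_add' _ _ _ hn'.ne']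
      gcongr
      linarith
    rw [hlog, ← EReal.coe_natCast, ← EReal.coe_div, ← EReal.coe_add]
    exact_mod_cast hreal
  have hconst : limsup (fun _ : ℕ => (δ : EReal)) atTop = δ := limsup_const _
  calc partitionEntropy f μ.1 P
      ≤ Dynamics.coverEntropyEntourage f Set.univ U + limsup (fun _ : ℕ => (δ : EReal)) atTop :=
        (limsup_le_limsup hle).trans <| EReal.limsup_add_le
          (.inr (hconst.trans_ne (EReal.coe_ne_top δ)))
          (.inr (hconst.trans_ne (EReal.coe_ne_bot δ)))
    _ = Dynamics.coverEntropyEntourage f Set.univ U + δ := by rw [hconst]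

variable {X : Type*} [UniformSpace X] [CompactSpace X] [TopologicalSpace.PseudoMetrizableSpace X]
  [MeasurableSpace X] [BorelSpace X]

lemma partitionEntropy_le_coverEntropy_add {f : X → X} (μ : InvMeasure f) {k : ℕ}
    {P : X → Fin k} (hP : Measurable P) {η : ℝ} (hη : 0 < η) :
    partitionEntropy f μ.1 P ≤ Dynamics.coverEntropy f Set.univ + (2 * η : ℝ) := by
  let c := Real.exp (-η)
  have hc₁ : c < 1 := Real.exp_lt_one_iff.2 (neg_lt_zero.2 hη)
  let L := Real.log (k / (1 - c))
  have hL : 0 ≤ L := log_natCast_div_one_sub_nonneg (Real.exp_pos _).le hc₁ k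
  obtain ⟨G, hG, hGη, hPG⟩ := exists_isClosed_continuousOn (μ := (μ.1 : Measure X)) hP
    (ENNReal.ofReal_pos.2 (by positivity : 0 < η / (L + 1))).ne'
  obtain ⟨U, hU, j, hj⟩ := exists_label_of_continuousOn hG.isCompact hPG
  have hGL : (μ.1 : Measure X).real Gᶜ * L ≤ η :=
    calc (μ.1 : Measure X).real Gᶜ * L ≤ η / (L + 1) * (L + 1) := by
          gcongr
          · exact ENNReal.toReal_le_of_le_ofReal (by positivity) hGη.le
          · linarith
      _ = η := by field_simp
  refine (partitionEntropy_le_coverEntropyEntourage_add μ hP hG.measurableSet.compl hU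
    (fun x y hxy hx => hj x y hxy (not_not.1 hx)) (Real.exp_pos (-η)) hc₁).trans ?_
  gcongr
  · exact Dynamics.coverEntropyEntourage_le_coverEntropy f Set.univ hU
  · rw [Real.log_exp]
    linarith

theorem entropy_le_coverEntropy {f : X → X} (μ : InvMeasure f) :
    entropy f μ ≤ Dynamics.coverEntropy f Set.univ := by
  refine iSup_le fun k => iSup₂_le fun P hP => ?_
  have hlim : Tendsto (fun η : ℝ => Dynamics.coverEntropy f Set.univ + ((2 * η : ℝ) : EReal))
      (𝓝[>] 0) (𝓝 (Dynamics.coverEntropy f Set.univ + ((2 * 0 : ℝ) : EReal))) :=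
    (EReal.continuousAt_add (.inr (EReal.coe_ne_bot _)) (.inr (EReal.coe_ne_top _))).tendsto.comp
      (tendsto_const_nhds.prodMk_nhds
        (continuous_coe_real_ereal.comp (continuous_const_mul 2)).continuousWithinAt)
  have hle := ge_of_tendsto hlim <| eventually_mem_nhdsWithin.mono fun η hη =>
    partitionEntropy_le_coverEntropy_add μ hP hη
  rwa [mul_zero, EReal.coe_zero, add_zero] at hle

end Goodwyn

section DirectedIntersection

variable {Y Z ι : Type*} [TopologicalSpace Y] [TopologicalSpace Z] [Nonempty ι] {K : ι → Set Y}

lemma image_iInter_of_directed_of_isCompact [T1Space Z] (hd : Directed (· ⊇ ·) K)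
    (hK : ∀ i, IsCompact (K i)) (hK_closed : ∀ i, IsClosed (K i)) {g : Y → Z}
    (hg : Continuous g) : g '' ⋂ i, K i = ⋂ i, g '' K i := by
  refine (Set.image_iInter_subset _ _).antisymm fun z hz => ?_
  have hfibre : IsClosed (g ⁻¹' {z}) := isClosed_singleton.preimage hg
  have hdir : Directed (· ⊇ ·) fun i => K i ∩ g ⁻¹' {z} := fun i j =>
    (hd i j).imp fun _ h => h.imp (Set.inter_subset_inter_left _) (Set.inter_subset_inter_left _)
  obtain ⟨y, hy⟩ := IsCompact.nonempty_iInter_of_directed_nonempty_isCompact_isClosed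
    (fun i => K i ∩ g ⁻¹' {z})
    hdir
    (fun i => (Set.mem_iInter.1 hz i).imp fun _ h => h)
    (fun i => (hK i).inter_right hfibre) (fun i => (hK_closed i).inter hfibre)
  rw [← Set.iInter_inter] at hy
  exact ⟨y, hy⟩

lemma isPreconnected_iInter_of_directed [T2Space Y] (hd : Directed (· ⊇ ·) K)
    (hK : ∀ i, IsCompact (K i)) (hK_conn : ∀ i, IsPreconnected (K i)) :
    IsPreconnected (⋂ i, K i) := by
  have hclosed : IsClosed (⋂ i, K i) := isClosed_iInter fun i => (hK i).isClosed
  have hcompact : IsCompact (⋂ i, K i) :=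
    (hK (Classical.arbitrary ι)).of_isClosed_subset hclosed (Set.iInter_subset K _)
  refine (isPreconnected_iff_subset_of_fully_disjoint_closed hclosed).2
    fun u v hu hv huv hdisj => ?_
  obtain ⟨U, V, hU, hV, huU, hvV, hUV⟩ := SeparatedNhds.of_isCompact_isCompact
    (hcompact.inter_right hu) (hcompact.inter_right hv)
    (hdisj.mono Set.inter_subset_right Set.inter_subset_right)
  obtain ⟨i, hi⟩ := exists_subset_nhds_of_isCompact hd hK (U := U ∪ V) fun y hy =>
    (hU.union hV).mem_nhds ((huv hy).imp (fun h => huU ⟨hy, h⟩) fun h => hvV ⟨hy, h⟩)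
  have hsub : ⋂ i, K i ⊆ K i := Set.iInter_subset K i
  rcases (hK_conn i).subset_or_subset hU hV hUV hi with hKU | hKV
  · exact .inl fun y hy => (huv hy).resolve_right fun hyv =>
      hUV.le_bot ⟨hKU (hsub hy), hvV ⟨hy, hyv⟩⟩
  · exact .inr fun y hy => (huv hy).resolve_left fun hyu =>
      hUV.le_bot ⟨huU ⟨hy, hyu⟩, hKV (hsub hy)⟩

end DirectedIntersection

section InvariantMeasures

lemma compactSpace_invMeasure {X : Type*} [TopologicalSpace X] [T2Space X] [CompactSpace X]
    [HasOuterApproxClosed X] [MeasurableSpace X] [BorelSpace X] {f : X → X} (hf : Continuous f) :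
    CompactSpace (InvMeasure f) := by
  have hfix : {μ : ProbabilityMeasure X | MeasurePreserving f (μ : Measure X) (μ : Measure X)} =
      {μ | μ.map hf.measurable.aemeasurable = μ} :=
    Set.ext fun μ => ⟨fun h => Subtype.ext h.map_eq,
      fun h => ⟨hf.measurable, congrArg Subtype.val h⟩⟩
  have hclosed : IsClosed {μ : ProbabilityMeasure X |
      MeasurePreserving f (μ : Measure X) (μ : Measure X)} :=
    hfix ▸ isClosed_eq (ProbabilityMeasure.continuous_map hf) continuous_id
  exact isCompact_iff_compactSpace.1 hclosed.isCompact

lemma continuous_integral_invMeasure {X : Type*} [TopologicalSpace X] [CompactSpace X]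
    [MeasurableSpace X] [OpensMeasurableSpace X] (f : X → X) {φ : X → ℝ} (hφ : Continuous φ) :
    Continuous fun μ : InvMeasure f => ∫ x, φ x ∂(μ.1 : Measure X) :=
  (ProbabilityMeasure.continuous_integral_continuousMap (⟨φ, hφ⟩ : C(X, ℝ))).comp
    continuous_subtype_val

end InvariantMeasures

section MaximizingMeasures

/-- The invariant measures maximizing the integral of `φ`. For `φ = α · Φ` they are those whose
rotation vector lies on the face `F_α(Φ)`. -/
def maximizingMeasures {X : Type*} [MeasurableSpace X] (f : X → X) (φ : X → ℝ) :
    Set (InvMeasure f) :=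
  {μ | ∀ ν : InvMeasure f, ∫ x, φ x ∂(ν.1 : Measure X) ≤ ∫ x, φ x ∂(μ.1 : Measure X)}

lemma entropy_add_mul_integral_le {X : Type*} [MeasurableSpace X] {f : X → X} {φ : X → ℝ} {t : ℝ}
    {μ : InvMeasure f} (hμ : μ ∈ equilibriumStates f fun x => t * φ x) (ν : InvMeasure f) :
    entropy f ν + (t * ∫ x, φ x ∂(ν.1 : Measure X) : ℝ) ≤
      entropy f μ + (t * ∫ x, φ x ∂(μ.1 : Measure X) : ℝ) := by
  have hle : freeEnergy f (fun x => t * φ x) ν ≤ freeEnergy f (fun x => t * φ x) μ :=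
    (le_iSup (freeEnergy f fun x => t * φ x) ν).trans_eq hμ.symm
  simpa only [freeEnergy, integral_const_mul] using hle

variable {X : Type*} [MetricSpace X] [MeasurableSpace X] [BorelSpace X]

theorem entropy_le_of_mem_groundStates {f : X → X} (husc : UpperSemicontinuous (entropy f))
    {φ : X → ℝ} {μ ν : InvMeasure f} (hμ : μ ∈ groundStates f φ)
    (hν : ν ∈ maximizingMeasures f φ) : entropy f ν ≤ entropy f μ := by
  obtain ⟨t, σ, -, ht, hσ, hlim⟩ := hμ
  by_contra! hlt
  obtain ⟨n, hn, htn⟩ := ((hlim.eventually (husc μ _ hlt)).and (ht.eventually_ge_atTop 0)).exists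
  refine hn.not_ge ((EReal.addLECancellable_coe
    (t n * ∫ x, φ x ∂((σ n).1 : Measure X))).add_le_add_iff_right.1 ?_)
  calc entropy f ν + (t n * ∫ x, φ x ∂((σ n).1 : Measure X) : ℝ)
      ≤ entropy f ν + (t n * ∫ x, φ x ∂(ν.1 : Measure X) : ℝ) := by
        gcongr entropy f ν + ((t n * ?_ : ℝ) : EReal)
        exact hν (σ n)
    _ ≤ entropy f (σ n) + (t n * ∫ x, φ x ∂((σ n).1 : Measure X) : ℝ) :=
        entropy_add_mul_integral_le (hσ n) ν

variable [CompactSpace X]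

theorem groundStates_subset_maximizingMeasures {f : X → X}
    (hent : ⨆ μ : InvMeasure f, entropy f μ < ⊤) {φ : X → ℝ} (hφ : Continuous φ) :
    groundStates f φ ⊆ maximizingMeasures f φ := by
  rintro μ ⟨t, σ, -, ht, hσ, hlim⟩ ν
  obtain ⟨C, hC, -⟩ := EReal.lt_iff_exists_real_btwn.1 hent
  have hσ_lim : Tendsto (fun n => C / t n + ∫ x, φ x ∂((σ n).1 : Measure X)) atTop
      (𝓝 (0 + ∫ x, φ x ∂(μ.1 : Measure X))) :=
    (ht.const_div_atTop C).add (((continuous_integral_invMeasure f hφ).tendsto μ).comp hlim)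
  rw [zero_add] at hσ_lim
  refine ge_of_tendsto hσ_lim ?_
  filter_upwards [ht.eventually_gt_atTop 0] with n hn
  have hle : ((0 + t n * ∫ x, φ x ∂(ν.1 : Measure X) : ℝ) : EReal) ≤
      ((C + t n * ∫ x, φ x ∂((σ n).1 : Measure X) : ℝ) : EReal) := by
    rw [EReal.coe_add, EReal.coe_add]
    exact (add_le_add_left (entropy_nonneg f ν) _).trans <|
      (entropy_add_mul_integral_le (hσ n) ν).trans <|
        add_le_add_left ((le_iSup (entropy f) (σ n)).trans hC.le) _
  rw [div_add' _ _ _ hn.ne', le_div_iff₀ hn]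
  linarith [EReal.coe_le_coe_iff.1 hle]

theorem isGreatest_entropy_of_mem_groundStates {f : X → X}
    (hent : ⨆ μ : InvMeasure f, entropy f μ < ⊤) (husc : UpperSemicontinuous (entropy f))
    {φ : X → ℝ} (hφ : Continuous φ) {μ : InvMeasure f} (hμ : μ ∈ groundStates f φ) :
    IsGreatest (entropy f '' maximizingMeasures f φ) (entropy f μ) :=
  ⟨Set.mem_image_of_mem _ (groundStates_subset_maximizingMeasures hent hφ hμ),
    Set.forall_mem_image.2 fun _ hν => entropy_le_of_mem_groundStates husc hμ hν⟩

end MaximizingMeasures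

section GroundStateLimits

/-- The equilibrium states of the potentials `t φ` with `t ≥ T`, that is, at inverse temperature
at least `T`. -/
def lowTempEquilibriumStates {X : Type*} [MeasurableSpace X] (f : X → X) (φ : X → ℝ) (T : ℝ) :
    Set (InvMeasure f) :=
  ⋃ t ≥ T, equilibriumStates f fun x => t * φ x

lemma antitone_lowTempEquilibriumStates {X : Type*} [MeasurableSpace X] (f : X → X) (φ : X → ℝ) :
    Antitone (lowTempEquilibriumStates f φ) :=
  fun _ _ hST => Set.biUnion_subset_biUnion_left fun _ ht => le_trans hST ht

lemma lowTempEquilibriumStates_eq_image {X : Type*} [MeasurableSpace X] {f : X → X} {φ : X → ℝ}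
    {T : ℝ} {μ : ℝ → InvMeasure f}
    (hμ : ∀ t ≥ T, equilibriumStates f (fun x => t * φ x) = {μ t}) :
    lowTempEquilibriumStates f φ T = μ '' Set.Ici T := by
  rw [lowTempEquilibriumStates, Set.iUnion₂_congr hμ]
  exact (Set.image_eq_iUnion μ (Set.Ici T)).symm

variable {X : Type*} [MetricSpace X] [MeasurableSpace X] [BorelSpace X]

theorem groundStates_eq_iInter_closure [SecondCountableTopology X] (f : X → X) (φ : X → ℝ) :
    groundStates f φ = ⋂ T, closure (lowTempEquilibriumStates f φ T) := by
  ext μ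
  rw [Set.mem_iInter]
  constructor
  · rintro ⟨t, σ, -, ht, hσ, hlim⟩ T
    refine mem_closure_of_tendsto hlim ?_
    filter_upwards [ht.eventually_ge_atTop T] with n hn
    exact Set.mem_iUnion₂.2 ⟨t n, hn, hσ n⟩
  · intro hμ
    have : FirstCountableTopology (InvMeasure f) :=
      (Topology.IsInducing.subtypeVal (Y := ProbabilityMeasure X)).firstCountableTopology
    obtain ⟨V, hV⟩ := (𝓝 μ).exists_antitone_basis
    have hex (n : ℕ) : ∃ t : ℝ, ∃ ν ∈ V n, n ≤ t ∧ ν ∈ equilibriumStates f fun x => t * φ x := by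
      obtain ⟨ν, hνV, hν⟩ := mem_closure_iff_nhds.1 (hμ n) _ (hV.mem n)
      obtain ⟨t, ht, hνt⟩ := Set.mem_iUnion₂.1 hν
      exact ⟨t, ν, hνV, ht, hνt⟩
    choose t σ hσV ht hσ using hex
    have ht_lim : Tendsto t atTop atTop := tendsto_atTop_mono ht tendsto_natCast_atTop_atTop
    obtain ⟨u, hu, htu⟩ := strictMono_subseq_of_tendsto_atTop ht_lim
    exact ⟨t ∘ u, σ ∘ u, htu, ht_lim.comp hu.tendsto_atTop, fun n => hσ (u n),
      (hV.tendsto hσV).comp hu.tendsto_atTop⟩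

variable [CompactSpace X] {Z : Type*} [TopologicalSpace Z] [T2Space Z] {f : X → X}

lemma image_groundStates_eq_iInter_closure (hf : Continuous f) (φ : X → ℝ)
    {g : InvMeasure f → Z} (hg : Continuous g) :
    g '' groundStates f φ = ⋂ T, closure (g '' lowTempEquilibriumStates f φ T) := by
  have := compactSpace_invMeasure hf
  have hanti : Antitone fun T => closure (lowTempEquilibriumStates f φ T) :=
    fun _ _ hST => closure_mono (antitone_lowTempEquilibriumStates f φ hST)
  rw [groundStates_eq_iInter_closure, image_iInter_of_directed_of_isCompact hanti.directed_ge
    (fun _ => isClosed_closure.isCompact) (fun _ => isClosed_closure) hg]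
  exact Set.iInter_congr fun T => image_closure_of_isCompact isClosed_closure.isCompact
    hg.continuousOn

lemma isCompact_groundStates (hf : Continuous f) (φ : X → ℝ) : IsCompact (groundStates f φ) := by
  have := compactSpace_invMeasure hf
  rw [groundStates_eq_iInter_closure]
  exact (isClosed_iInter fun _ => isClosed_closure).isCompact

lemma nonempty_groundStates (hf : Continuous f) {φ : X → ℝ}
    (hφ : ∀ T, (lowTempEquilibriumStates f φ T).Nonempty) : (groundStates f φ).Nonempty := by
  have := compactSpace_invMeasure hf
  have hanti : Antitone fun T => closure (lowTempEquilibriumStates f φ T) :=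
    fun _ _ hST => closure_mono (antitone_lowTempEquilibriumStates f φ hST)
  rw [groundStates_eq_iInter_closure]
  exact IsCompact.nonempty_iInter_of_directed_nonempty_isCompact_isClosed _ hanti.directed_ge
    (fun T => (hφ T).closure) (fun _ => isClosed_closure.isCompact) fun _ => isClosed_closure

theorem isConnected_image_groundStates (hf : Continuous f) {φ : X → ℝ} {g : InvMeasure f → Z}
    (hg : Continuous g) {t₀ : ℝ} {μ : ℝ → InvMeasure f}
    (hμ : ∀ t ≥ t₀, equilibriumStates f (fun x => t * φ x) = {μ t})
    (hcont : ContinuousOn (fun t => g (μ t)) (Set.Ici t₀)) :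
    IsConnected (g '' groundStates f φ) := by
  have := compactSpace_invMeasure hf
  let K (T : ℝ) : Set Z := closure (g '' lowTempEquilibriumStates f φ T)
  have hK_anti : Antitone K := fun _ _ hST =>
    closure_mono (Set.image_mono (antitone_lowTempEquilibriumStates f φ hST))
  have hK (T : ℝ) : IsCompact (K T) := by
    simpa only [K, image_closure_of_isCompact isClosed_closure.isCompact hg.continuousOn] using
      (isClosed_closure (s := lowTempEquilibriumStates f φ T)).isCompact.image hg
  have htail {T : ℝ} (hT : t₀ ≤ T) : lowTempEquilibriumStates f φ T = μ '' Set.Ici T :=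
    lowTempEquilibriumStates_eq_image fun t ht => hμ t (hT.trans ht)
  have hK_conn {T : ℝ} (hT : t₀ ≤ T) : IsPreconnected (K T) := by
    simp only [K, htail hT, Set.image_image]
    exact (isPreconnected_Ici.image _ (hcont.mono (Set.Ici_subset_Ici.2 hT))).closure
  refine ⟨(nonempty_groundStates hf fun T => ?_).image g, ?_⟩
  · refine .mono (antitone_lowTempEquilibriumStates f φ (le_max_left T t₀)) ?_
    rw [htail (le_max_right T t₀)]
    exact Set.nonempty_Ici.image μ
  · have hmax : Tendsto (fun T => max T t₀) atTop atTop :=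
      tendsto_atTop_mono (fun T => le_max_left T t₀) tendsto_id
    rw [image_groundStates_eq_iInter_closure hf φ hg, ← hK_anti.iInter_comp_tendsto_atTop hmax]
    exact isPreconnected_iInter_of_directed
      (hK_anti.comp_monotone fun S T h => max_le_max_right t₀ h).directed_ge
      (fun T => hK _) fun T => hK_conn (le_max_right T t₀)

end GroundStateLimits

section RotationVectors

variable {X : Type*} [MetricSpace X] {m : ℕ}

lemma continuous_dirPotential (α : EuclideanSpace ℝ (Fin m))
    (Φ : C(X, EuclideanSpace ℝ (Fin m))) : Continuous (dirPotential α Φ) := by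
  unfold dirPotential
  fun_prop

variable [CompactSpace X] [MeasurableSpace X] [BorelSpace X]

lemma continuous_rv (f : X → X) (Φ : C(X, EuclideanSpace ℝ (Fin m))) :
    Continuous (rv (f := f) Φ) :=
  (PiLp.continuous_toLp 2 _).comp <| continuous_pi fun i =>
    continuous_integral_invMeasure f (by fun_prop : Continuous fun x => Φ x i)

lemma integral_dirPotential {f : X → X} (α : EuclideanSpace ℝ (Fin m))
    (Φ : C(X, EuclideanSpace ℝ (Fin m))) (μ : InvMeasure f) :
    ∫ x, dirPotential α Φ x ∂(μ.1 : Measure X) = inner ℝ α (rv Φ μ) := by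
  have hint (i : Fin m) : Integrable (fun x => α i * Φ x i) (μ.1 : Measure X) :=
    (by fun_prop : Continuous fun x => α i * Φ x i).integrable_of_hasCompactSupport
      (HasCompactSupport.of_compactSpace _)
  simp only [dirPotential]
  rw [integral_finsetSum _ fun i _ => hint i]
  simp only [integral_const_mul, PiLp.inner_apply, rv, RCLike.inner_apply, conj_trivial, mul_comm]

lemma rv_mem_face_iff {f : X → X} {Φ : C(X, EuclideanSpace ℝ (Fin m))}
    {α : EuclideanSpace ℝ (Fin m)} {μ : InvMeasure f} :
    rv Φ μ ∈ face f Φ α ↔ μ ∈ maximizingMeasures f (dirPotential α Φ) := by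
  simp only [maximizingMeasures, Set.mem_ofPred_eq, integral_dirPotential]
  constructor
  · rintro ⟨-, -, haway⟩ ν
    exact not_lt.1 (haway _ ⟨ν, rfl⟩)
  · intro hmax
    refine ⟨⟨μ, rfl⟩, ⟨fun ε hε => ⟨_, ⟨μ, rfl⟩, _, rfl, by rwa [dist_self]⟩, ?_⟩, ?_⟩
    · rintro ⟨-, -, ⟨ν, rfl⟩, hν⟩
      exact hν.not_ge (hmax ν)
    · rintro - ⟨ν, rfl⟩
      exact (hmax ν).not_gt

end RotationVectors

end GroundStates

theorem theorem1 {X : Type*} [MetricSpace X] [CompactSpace X] [MeasurableSpace X] [BorelSpace X]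
    (f : X → X) (hf : Continuous f)
    (htop : Dynamics.coverEntropy f Set.univ < ⊤)
    (husc : UpperSemicontinuous (GroundStates.entropy f))
    {m : ℕ} (Φ : C(X, EuclideanSpace ℝ (Fin m)))
    (α : EuclideanSpace ℝ (Fin m)) (hα : ‖α‖ = 1) :
    (∀ μ ∈ GroundStates.groundStates f (GroundStates.dirPotential α Φ),
      GroundStates.rv Φ μ ∈ GroundStates.face f Φ α ∧
      GroundStates.entropy f μ =
        sSup (GroundStates.entropy f ''
          {ν : GroundStates.InvMeasure f | GroundStates.rv Φ ν ∈ GroundStates.face f Φ α})) ∧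
    IsCompact (GroundStates.rv Φ ''
      GroundStates.groundStates f (GroundStates.dirPotential α Φ)) ∧
    (∀ (t₀ : ℝ) (μ : ℝ → GroundStates.InvMeasure f),
      (∀ t ≥ t₀, GroundStates.equilibriumStates f
        (fun x => t * GroundStates.dirPotential α Φ x) = {μ t}) →
      ContinuousOn (fun t => GroundStates.rv Φ (μ t)) (Set.Ici t₀) →
      IsConnected (GroundStates.rv Φ ''
        GroundStates.groundStates f (GroundStates.dirPotential α Φ))) := by
  have hent : ⨆ μ : GroundStates.InvMeasure f, GroundStates.entropy f μ < ⊤ :=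
    (iSup_le GroundStates.entropy_le_coverEntropy).trans_lt htop
  have hφ := GroundStates.continuous_dirPotential α Φ
  have hrv := GroundStates.continuous_rv f Φ
  refine ⟨fun μ hμ => ⟨?_, ?_⟩, (GroundStates.isCompact_groundStates hf _).image hrv,
    fun t₀ μ hμ hcont => GroundStates.isConnected_image_groundStates hf hrv hμ hcont⟩
  · exact GroundStates.rv_mem_face_iff.2 <|
      GroundStates.groundStates_subset_maximizingMeasures hent hφ hμ
  · simp only [GroundStates.rv_mem_face_iff, Set.ofPred_mem_eq]
    exact (GroundStates.isGreatest_entropy_of_mem_groundStates hent husc hφ hμ).isLUB.sSup_eq.symm
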